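/- For a meromorphic function $f$ on $\mathbb{C}$ let $T(r,f)$ be its Nevanlinna characteristic and let $$\sigma(f)=\limsup_{r\to\infty}\frac{\log^{+}T(r,f)}{\log r}$$ be its order. For a measurable set $E\subset(1,\infty)$ let $\operatorname{lm}(E)=\int_E \frac{dr}{r}$ be its logarithmic measure. **Theorem.** Let $f\not\equiv 0$ be a meromorphic function on $\mathbb{C}$ of order $\sigma(f)=\sigma<1$, and let $\eta$ be a fixed non-zero complex number. Then for any $\varepsilon>0$ there exists a measurable set $E\subset(1,\infty)$ of finite logarithmic measure such that, for all $z\in\mathbb{C}$ with $|z|=r\notin E\cup[0,1]$, $f$ is holomorphic at $z$ and at $z+\eta$, $f(z)\neq 0$, and $$\frac{\Delta f(z)}{f(z)}=\frac{f(z+\eta)-f(z)}{f(z)}=\eta\,\frac{f'(z)}{f(z)}+O\big(r^{2\sigma-2+\varepsilon}\big).$$ Here $\Delta f(z)=f(z+\eta)-f(z)$, and the $O$-term means that there are constants $K>0$ and $r_0>0$ such that $$\left|\frac{f(z+\eta)-f(z)}{f(z)}-\eta\,\frac{f'(z)}{f(z)}\right|\le K\,r^{2\sigma-2+\varepsilon}$$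 for all $z$ with $|z|=r\notin E\cup[0,1]$ and $r>r_0$. The set $E$ and the constants $K$, $r_0$ may depend on $f$, $\eta$ and $\varepsilon$. -/

import Mathlib

open scoped ENNReal

noncomputable section

/-- The logarithmic measure `lm(E) = ∫_{E ∩ (1,∞)} dr / r` of a set `E` of positive reals, as an
extended nonnegative real number. -/
def logarithmicMeasure (E : Set ℝ) : ℝ≥0∞ :=
  ∫⁻ r in E ∩ Set.Ioi 1, ENNReal.ofReal (1 / r)

/-- The (Nevanlinna) order of growth `σ(f) = limsup_{r → ∞} log⁺ T(r, f) / log r` of a meromorphic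
function `f` on the complex plane, where `T(r, f) = m(r, f) + N(r, f)` is the Nevanlinna
characteristic (for the value `∞`). The upper limit is taken in the extended reals, so that functions
of infinite order get the value `⊤`. -/
def nevanlinnaOrder (f : ℂ → ℂ) : EReal :=
  Filter.limsup
    (fun r : ℝ ↦
      ((Real.posLog (ValueDistribution.characteristic f ⊤ r) / Real.log r : ℝ) : EReal))
    Filter.atTop

end

open Complex Metric Real Set Filter Topology MeasureTheory
open scoped ENNReal

/-! Fix `σ < τ < β < min 1 (σ + ε / 2)`. The error term is the second-order Taylor remainder of `φ w
= f w / f z` at `z`. If `φ` is holomorphic and bounded by an absolute constant on a disk of radius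
`ρ = r ^ (1 - β) / 2`, Cauchy's estimates make the remainder `O(‖η‖ ^ 2 / ρ ^ 2) = O(r ^ (2 * β -
2))`. Since `β < 1`, `ρ` eventually exceeds `4 * ‖η‖`.

The bound on `φ` comes from Poisson–Jensen on the disk of radius `2 * r`
(`log_norm_le_of_norm_sub_le`). The boundary integral changes by `O(ρ / r)` times the
characteristics of `f` and `f⁻¹`, hence by `O(1)`. The zeros and poles contribute at most `4 * ρ *
S`, where `S` bounds the sum of `1 / |r - ‖i‖|` over them with multiplicity. So `S ≤ r ^ (β - 1)` is
exactly what is needed, and it also keeps the disk free of zeros and poles.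

That bound holds outside a small set of radii (`exists_sum_inv_abs_sub_le`). The order being below
`τ` makes `∑ |i| ^ (-τ)` converge (with `|i|` replaced by `max |i| 1`). The sum of the powers `|r -
‖i‖| ^ (-p)`, with `p = τ / β < 1`, is therefore integrable against a suitable weight. Markov's
inequality controls it outside a set of finite logarithmic measure, and comparing `ℓ^p` with `ℓ^1`
returns to exponent one. -/

/-! ### Elementary estimates: logarithm, Poisson kernel, Taylor remainder. -/

theorem abs_log_norm_sub_log_norm_le {a b : ℂ} (hb : b ≠ 0) (h : ‖a - b‖ ≤ ‖b‖ / 2) :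
    |Real.log ‖a‖ - Real.log ‖b‖| ≤ 2 * (‖a - b‖ / ‖b‖) := by
  have hb' : 0 < ‖b‖ := norm_pos_iff.2 hb
  have h1 : |‖a‖ - ‖b‖| ≤ ‖a - b‖ := abs_norm_sub_norm_le a b
  have h2 := abs_le.1 h1
  have ha : ‖b‖ / 2 ≤ ‖a‖ := by linarith
  have ha' : 0 < ‖a‖ := by linarith
  rw [abs_le]
  constructor
  · have := Real.log_le_sub_one_of_pos (div_pos hb' ha')
    rw [Real.log_div hb'.ne' ha'.ne'] at this
    have h3 : ‖b‖ / ‖a‖ - 1 ≤ 2 * (‖a - b‖ / ‖b‖) := by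
      rw [div_sub_one ha'.ne', ← mul_div_assoc, div_le_div_iff₀ ha' hb']
      nlinarith [norm_nonneg (a - b)]
    linarith
  · have := Real.log_le_sub_one_of_pos (div_pos ha' hb')
    rw [Real.log_div ha'.ne' hb'.ne'] at this
    have h3 : ‖a‖ / ‖b‖ - 1 ≤ ‖a - b‖ / ‖b‖ := by
      rw [div_sub_one hb'.ne']
      gcongr
      linarith
    have : 0 ≤ ‖a - b‖ / ‖b‖ := by positivity
    linarith

theorem abs_re_herglotzRieszKernel_sub_le {R : ℝ} {ζ w z : ℂ} (hζ : ‖ζ‖ = R) (hw : ‖w‖ < R)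
    (hz : ‖z‖ < R) :
    |(herglotzRieszKernel 0 w ζ).re - (herglotzRieszKernel 0 z ζ).re|
      ≤ 2 * R * ‖w - z‖ / ((R - ‖w‖) * (R - ‖z‖)) := by
  have key (x : ℂ) : R - ‖x‖ ≤ ‖ζ - x‖ := by
    rw [← hζ]; exact norm_sub_norm_le ζ x
  have hw0 : ζ - w ≠ 0 := norm_pos_iff.1 (by linarith [key w])
  have hz0 : ζ - z ≠ 0 := norm_pos_iff.1 (by linarith [key z])
  have : herglotzRieszKernel 0 w ζ - herglotzRieszKernel 0 z ζ
      = 2 * ζ * (w - z) / ((ζ - w) * (ζ - z)) := by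
    simp only [herglotzRieszKernel_def, sub_zero]
    field_simp
    ring
  rw [← Complex.sub_re, this]
  refine (Complex.abs_re_le_norm _).trans ?_
  simp only [norm_div, norm_mul, hζ, Complex.norm_ofNat]
  have := norm_nonneg z
  have : 0 < R := by linarith
  have h1 := key w
  have h2 := key z
  have h3 : 0 < R - ‖w‖ := by linarith
  have h4 : 0 < R - ‖z‖ := by linarith
  gcongr

/-- Cauchy's estimate is used twice, on circles of radius `ρ / 8` and then `ρ / 4`, which bounds the
second derivative by `32 * M / ρ ^ 2` near `z`. Two mean value inequalities turn this into the
remainder bound. -/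
theorem norm_sub_sub_mul_deriv_le {φ : ℂ → ℂ} {z η : ℂ} {ρ M : ℝ}
    (hφ : DifferentiableOn ℂ φ (ball z ρ)) (hM : ∀ w ∈ ball z ρ, ‖φ w‖ ≤ M)
    (hη : ‖η‖ < ρ / 4) :
    ‖φ (z + η) - φ z - η * deriv φ z‖ ≤ 32 * M * ‖η‖ ^ 2 / ρ ^ 2 := by
  have hρ : 0 < ρ := by linarith [norm_nonneg η]
  have hφ' : DifferentiableOn ℂ (deriv φ) (ball z ρ) := hφ.deriv isOpen_ball
  have b1 : ∀ w ∈ ball z (3 * ρ / 4), ‖deriv φ w‖ ≤ M / (ρ / 8) := by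
    intro w hw
    have hsub : closedBall w (ρ / 8) ⊆ ball z ρ :=
      closedBall_subset_ball' (by rw [mem_ball] at hw; linarith)
    refine Complex.norm_deriv_le_of_forall_mem_sphere_norm_le (by positivity) ?_ fun x hx ↦
      hM x (hsub (sphere_subset_closedBall hx))
    exact (hφ.mono (by rw [closure_ball _ (by positivity)]; exact hsub)).diffContOnCl
  have b2 : ∀ w ∈ ball z (ρ / 4), ‖deriv (deriv φ) w‖ ≤ M / (ρ / 8) / (ρ / 4) := by
    intro w hw
    have hsub : closedBall w (ρ / 4) ⊆ ball z (3 * ρ / 4) :=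
      closedBall_subset_ball' (by rw [mem_ball] at hw; linarith)
    have hsub' := hsub.trans (ball_subset_ball (by linarith : 3 * ρ / 4 ≤ ρ))
    refine Complex.norm_deriv_le_of_forall_mem_sphere_norm_le (by positivity) ?_ fun x hx ↦
      b1 x (hsub (sphere_subset_closedBall hx))
    exact (hφ'.mono (by rw [closure_ball _ (by positivity)]; exact hsub')).diffContOnCl
  have hzz : z ∈ ball z (ρ / 4) := mem_ball_self (by positivity)
  have hsm : ball z (ρ / 4) ⊆ ball z ρ := ball_subset_ball (by linarith)
  have hηz : z + η ∈ closedBall z ‖η‖ := by simp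
  have hcb : closedBall z ‖η‖ ⊆ ball z (ρ / 4) := closedBall_subset_ball hη
  have b3 : ∀ w ∈ closedBall z ‖η‖, ‖deriv φ w - deriv φ z‖ ≤ M / (ρ / 8) / (ρ / 4) * ‖η‖ := by
    intro w hw
    have hM0 : 0 ≤ M / (ρ / 8) / (ρ / 4) := (norm_nonneg _).trans (b2 z hzz)
    refine ((convex_ball z (ρ / 4)).norm_image_sub_le_of_norm_deriv_le (f := deriv φ)
      (fun x hx ↦ hφ'.differentiableAt (isOpen_ball.mem_nhds (hsm hx))) b2 hzz (hcb hw)).trans ?_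
    gcongr
    rwa [mem_closedBall, dist_eq_norm] at hw
  have hd : ∀ x ∈ ball z ρ, DifferentiableAt ℂ φ x :=
    fun x hx ↦ hφ.differentiableAt (isOpen_ball.mem_nhds hx)
  have := (convex_closedBall z ‖η‖).norm_image_sub_le_of_norm_hasDerivWithin_le
    (f := fun w ↦ φ w - w * deriv φ z) (f' := fun w ↦ deriv φ w - deriv φ z)
    (fun x hx ↦ by
      have := (hd x (hsm (hcb hx))).hasDerivAt.sub ((hasDerivAt_id x).mul_const (deriv φ z))
      simpa [Pi.sub_def] using this.hasDerivWithinAt) b3 (mem_closedBall_self (norm_nonneg _)) hηz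
  simp only [add_sub_cancel_left] at this
  calc _ = ‖φ (z + η) - (z + η) * deriv φ z - (φ z - z * deriv φ z)‖ := by ring_nf
    _ ≤ _ := this
    _ = _ := by field_simp; ring

/-! ### Poisson–Jensen and local control of `log ‖f‖`. -/

/-- **Poisson–Jensen formula** on a disk whose boundary circle carries no zeros or poles. -/
theorem log_norm_add_sum_log_norm_canonicalFactor {f : ℂ → ℂ} {R : ℝ} {w : ℂ}
    (hf : MeromorphicNFOn f univ) (htop : ∀ u, meromorphicOrderAt f u ≠ ⊤) (hR : 0 < R)
    (hS : ∀ u ∈ sphere (0 : ℂ) R, meromorphicOrderAt f u = 0) (hw : w ∈ ball (0 : ℂ) R)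
    (hw0 : meromorphicOrderAt f w = 0) :
    Real.circleAverage ((Complex.re ∘ herglotzRieszKernel 0 w) • (Real.log ‖f ·‖)) 0 R
      = Real.log ‖f w‖ + ∑ᶠ i, MeromorphicOn.divisor f (ball 0 R) i
          * Real.log ‖canonicalFactor R i w‖ := by
  have hm : MeromorphicOn f (closedBall 0 R) := fun x _ ↦ (hf (mem_univ x)).meromorphicAt
  -- Dividing out the canonical factors leaves a zero-free analytic `h`, so `log ‖h‖` is harmonic.
  -- On the circle those factors have modulus one, so there `‖h‖ = ‖f‖`.
  obtain ⟨h, D⟩ := hm.exists_ecanonicalDecomp (fun u ↦ htop u)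
  have hsph (i) : MeromorphicOn.divisor f (sphere 0 R) i = 0 := by
    rw [MeromorphicOn.divisor_def]
    split_ifs with hi
    · simp [hS i hi.2]
    · rfl
  have htc (x) (hx : meromorphicOrderAt f x = 0) : meromorphicTrailingCoeffAt f x = f x :=
    AnalyticAt.meromorphicTrailingCoeffAt_of_ne_zero
      ((hf (mem_univ x)).meromorphicOrderAt_nonneg_iff_analyticAt.1 hx.ge)
      ((hf (mem_univ x)).meromorphicOrderAt_eq_zero_iff.1 hx)
  have hlog (x) (hx : x ∈ closedBall (0 : ℂ) R) (hx0 : meromorphicOrderAt f x = 0) :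
      Real.log ‖h x‖ = ∑ᶠ i, MeromorphicOn.divisor f (ball 0 R) i
          * Real.log ‖canonicalFactor R i x‖ + Real.log ‖f x‖ := by
    rw [D.log_norm_eq hx hx0 hR, htc x hx0]
    simp [hsph]
  have hharm := InnerProductSpace.HarmonicOnNhd.circleAverage_re_herglotzRieszKernel_smul
    (f := fun x ↦ Real.log ‖h x‖) (c := 0) (R := R) (w := w)
    (fun x hx ↦ (D.analyticOnNhd x hx).harmonicAt_log_norm (D.ne_zero x hx)) hw
  rw [hlog w (ball_subset_closedBall hw) hw0, add_comm] at hharm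
  rw [← hharm]
  refine Real.circleAverage_congr_sphere fun x hx ↦ ?_
  rw [abs_of_pos hR] at hx
  simp only [Pi.smul_apply', smul_eq_mul]
  rw [hlog x (sphere_subset_closedBall hx) (hS x hx), finsum_eq_zero_of_forall_eq_zero, zero_add]
  intro i
  by_cases hi : i ∈ ball (0 : ℂ) R
  · simp [norm_canonicalFactor_eval_circle_eq_one hi hx]
  · simp [hi]

theorem circleAverage_abs_log_norm {f : ℂ → ℂ} (hf : Meromorphic f) (R : ℝ) :
    Real.circleAverage (fun z ↦ |Real.log ‖f z‖|) 0 R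
      = ValueDistribution.proximity f ⊤ R + ValueDistribution.proximity f⁻¹ ⊤ R := by
  rw [ValueDistribution.proximity_top, ValueDistribution.proximity_top,
    ← Real.circleAverage_add hf.meromorphicOn.circleIntegrable_posLog_norm
      hf.inv.meromorphicOn.circleIntegrable_posLog_norm]
  congr 1
  ext z
  simp only [Pi.add_apply, Pi.inv_apply, norm_inv, Real.posLog, Real.log_inv]
  rcases le_total 0 (Real.log ‖f z‖) with h | h
  · simp [h, abs_of_nonneg]
  · simp [h, abs_of_nonpos]

theorem circleAverage_abs_log_norm_le {f : ℂ → ℂ} (hf : Meromorphic f) {R : ℝ} (hR : 1 ≤ R) :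
    Real.circleAverage (fun z ↦ |Real.log ‖f z‖|) 0 R
      ≤ ValueDistribution.characteristic f ⊤ R + ValueDistribution.characteristic f⁻¹ ⊤ R := by
  rw [circleAverage_abs_log_norm hf]
  simp only [ValueDistribution.characteristic, Pi.add_apply]
  have h1 := ValueDistribution.logCounting_nonneg (f := f) (e := ⊤) hR
  have h2 := ValueDistribution.logCounting_nonneg (f := f⁻¹) (e := ⊤) hR
  linarith

theorem abs_circleAverage_herglotz_sub_le {f : ℂ → ℂ} (hf : Meromorphic f) {R : ℝ} {w z : ℂ}
    (hw : ‖w‖ < R) (hz : ‖z‖ < R) :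
    |Real.circleAverage ((Complex.re ∘ herglotzRieszKernel 0 w) • (Real.log ‖f ·‖)) 0 R
        - Real.circleAverage ((Complex.re ∘ herglotzRieszKernel 0 z) • (Real.log ‖f ·‖)) 0 R|
      ≤ 2 * R * ‖w - z‖ / ((R - ‖w‖) * (R - ‖z‖))
        * Real.circleAverage (fun z ↦ |Real.log ‖f z‖|) 0 R := by
  have hR : 0 < R := (norm_nonneg w).trans_lt hw
  have hint : CircleIntegrable (Real.log ‖f ·‖) 0 R :=
    hf.meromorphicOn.circleIntegrable_log_norm
  have hk (x : ℂ) (hx : ‖x‖ < R) :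
      CircleIntegrable ((Complex.re ∘ herglotzRieszKernel 0 x) • (Real.log ‖f ·‖)) 0 R :=
    hint.continuousOn_smul <| Complex.continuous_re.comp_continuousOn
      (continuousOn_herglotzRieszKernel_sphere (by simpa using hx))
  rw [← Real.circleAverage_sub (hk w hw) (hk z hz)]
  refine Real.abs_circleAverage_le_circleAverage_abs.trans ?_
  rw [← smul_eq_mul, ← Real.circleAverage_fun_smul]
  refine Real.circleAverage_mono ((hk w hw).sub (hk z hz)).abs
    (hint.abs.const_smul) fun x hx ↦ ?_
  rw [abs_of_pos hR, mem_sphere_zero_iff_norm] at hx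
  change |(herglotzRieszKernel 0 w x).re * Real.log ‖f x‖
    - (herglotzRieszKernel 0 z x).re * Real.log ‖f x‖| ≤ _ * |Real.log ‖f x‖|
  rw [← sub_mul, abs_mul]
  gcongr
  exact abs_re_herglotzRieszKernel_sub_le hx hw hz

/-- The numerator is at least `2 * r ^ 2` at `z` and moves by at most `2 * r * ρ`. The factor `x -
i` is at least `|r - ‖i‖|` at `z` and moves by at most `ρ`. Each changes the logarithm by at most `2
* ρ / |r - ‖i‖|`. -/
theorem abs_log_norm_canonicalFactor_sub_le {r ρ : ℝ} {i w z : ℂ} (hr : 0 < r) (hz : ‖z‖ = r)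
    (hi : ‖i‖ < 2 * r) (hir : ‖i‖ ≠ r) (hwz : ‖w - z‖ ≤ ρ) (hρ : ρ ≤ r / 2)
    (hρi : ρ ≤ |r - ‖i‖| / 2) :
    |Real.log ‖canonicalFactor (2 * r) i w‖ - Real.log ‖canonicalFactor (2 * r) i z‖|
      ≤ 4 * ρ * |r - ‖i‖|⁻¹ := by
  have hd : 0 < |r - ‖i‖| := abs_pos.2 (sub_ne_zero.2 hir.symm)
  have hdr : |r - ‖i‖| ≤ r := abs_le.2 ⟨by linarith, by linarith [norm_nonneg i]⟩
  have hzi : |r - ‖i‖| ≤ ‖z - i‖ := by rw [← hz]; exact abs_norm_sub_norm_le z i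
  have hzi0 : z - i ≠ 0 := norm_pos_iff.1 (by linarith)
  have hwi : ‖z - i‖ - ρ ≤ ‖w - i‖ := by
    have := norm_sub_norm_le (z - i) (z - w)
    rw [norm_sub_rev z w] at this
    have h : z - i - (z - w) = w - i := by ring
    rw [h] at this
    linarith
  have hwi0 : w - i ≠ 0 := norm_pos_iff.1 (by linarith)
  set c : ℂ → ℂ := fun x ↦ ((2 * r : ℝ) : ℂ) ^ 2 - (starRingEnd ℂ) i * x with hc
  have hcz : 2 * r * r ≤ ‖c z‖ := by
    have h1 := norm_sub_norm_le (((2 * r : ℝ) : ℂ) ^ 2) ((starRingEnd ℂ) i * z)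
    have h2 : ‖((2 * r : ℝ) : ℂ) ^ 2‖ = (2 * r) ^ 2 := by
      rw [norm_pow, Complex.norm_real, Real.norm_of_nonneg (by positivity)]
    rw [norm_mul, RCLike.norm_conj, hz, h2] at h1
    simp only [hc]
    nlinarith
  have hcz0 : c z ≠ 0 := norm_pos_iff.1 (by nlinarith)
  have hcwz : ‖c w - c z‖ ≤ 2 * r * ρ := by
    have h : c w - c z = - ((starRingEnd ℂ) i * (w - z)) := by simp only [hc]; ring
    rw [h, norm_neg, norm_mul, RCLike.norm_conj]
    gcongr
  have hcw0 : c w ≠ 0 := by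
    intro h
    rw [h, zero_sub, norm_neg] at hcwz
    nlinarith
  have e (x : ℂ) (hx : c x ≠ 0) (hx' : x - i ≠ 0) :
      Real.log ‖canonicalFactor (2 * r) i x‖
        = Real.log ‖c x‖ - (Real.log (2 * r) + Real.log ‖x - i‖) := by
    rw [canonicalFactor_apply, norm_div, norm_mul, Real.log_div (norm_ne_zero_iff.2 hx),
      Real.log_mul, Complex.norm_real, Real.norm_of_nonneg (by positivity)]
    · rw [Complex.norm_real, Real.norm_of_nonneg (by positivity)]; positivity
    · exact norm_ne_zero_iff.2 hx'
    · rw [← norm_mul, norm_ne_zero_iff]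
      refine mul_ne_zero ?_ hx'
      exact_mod_cast (by positivity : 2 * r ≠ 0)
  have hρ0 : 0 ≤ ρ := (norm_nonneg _).trans hwz
  have b1 := abs_log_norm_sub_log_norm_le hcz0 (a := c w) (by nlinarith)
  have b2 := abs_log_norm_sub_log_norm_le hzi0 (a := w - i)
    (by rw [sub_sub_sub_cancel_right]; linarith)
  rw [sub_sub_sub_cancel_right] at b2
  have c1 : ‖c w - c z‖ / ‖c z‖ ≤ ρ * |r - ‖i‖|⁻¹ := by
    calc _ ≤ 2 * r * ρ / (2 * r * r) := by gcongr
      _ = ρ * r⁻¹ := by field_simp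
      _ ≤ _ := by gcongr
  have c2 : ‖w - z‖ / ‖z - i‖ ≤ ρ * |r - ‖i‖|⁻¹ := by
    rw [div_eq_mul_inv]
    gcongr
  rw [e w hcw0 hwi0, e z hcz0 hzi0]
  rw [abs_le] at b1 b2 ⊢
  constructor <;> linarith

/-- Near a point `z` that keeps its distance from the zeros and poles of `f`, the modulus of `f`
does not exceed a fixed multiple of `‖f z‖`, provided `f` grows slowly enough. -/
theorem log_norm_le_of_norm_sub_le {f : ℂ → ℂ} {r ρ S : ℝ} {w z : ℂ}
    (hf : MeromorphicNFOn f univ) (htop : ∀ u, meromorphicOrderAt f u ≠ ⊤) (hr : 1 ≤ r)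
    (hsph : ∀ u, meromorphicOrderAt f u ≠ 0 → ‖u‖ ≠ r ∧ ‖u‖ ≠ 2 * r) (hz : ‖z‖ = r)
    (hS : ∀ s : Finset ℂ, (∀ i ∈ s, ‖i‖ < 2 * r) →
      ∑ i ∈ s, |(MeromorphicOn.divisor f univ i : ℝ)| * |r - ‖i‖|⁻¹ ≤ S)
    (hwz : ‖w - z‖ ≤ ρ) (hρ : ρ ≤ r / 2) (hρS : ρ * S ≤ 1 / 2) :
    meromorphicOrderAt f w = 0 ∧ Real.log ‖f w‖ ≤ Real.log ‖f z‖ + 2 + 8 * (ρ / r) *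
      (ValueDistribution.characteristic f ⊤ (2 * r)
        + ValueDistribution.characteristic f⁻¹ ⊤ (2 * r)) := by
  have hr0 : 0 < r := by linarith
  have hm : Meromorphic f := fun x ↦ (hf (mem_univ x)).meromorphicAt
  have hD (i : ℂ) : MeromorphicOn.divisor f univ i = (meromorphicOrderAt f i).untop₀ :=
    MeromorphicOn.divisor_apply hm.meromorphicOn (mem_univ i)
  have hD0 (i : ℂ) : MeromorphicOn.divisor f univ i = 0 ↔ meromorphicOrderAt f i = 0 := by
    rw [hD, WithTop.untop₀_eq_zero]
    simp [htop i]
  have hρ0 : 0 ≤ ρ := (norm_nonneg _).trans hwz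
  have hw : ‖w‖ ≤ 3 * r / 2 := by
    have := norm_sub_norm_le w z
    linarith
  -- A single term of the sum is already at most `S`, since multiplicities are at least one; thus
  -- the sum bound alone separates the disk from zeros and poles.
  have hsep (i : ℂ) (hi : ‖i‖ < 2 * r) (hi0 : meromorphicOrderAt f i ≠ 0) :
      ρ ≤ |r - ‖i‖| / 2 := by
    have h1 := hS {i} (by simpa using hi)
    have hd : 0 < |r - ‖i‖| := abs_pos.2 (sub_ne_zero.2 (hsph i hi0).1.symm)
    rw [Finset.sum_singleton] at h1
    have h2 : (1 : ℝ) ≤ |(MeromorphicOn.divisor f univ i : ℝ)| := by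
      rw [← Int.cast_abs]
      exact_mod_cast Int.one_le_abs (mt (hD0 i).1 hi0)
    have h3 : |r - ‖i‖|⁻¹ ≤ S := le_trans (le_mul_of_one_le_left (by positivity) h2) h1
    have h4 : ρ * |r - ‖i‖|⁻¹ ≤ 1 / 2 := (by gcongr : _ ≤ ρ * S).trans hρS
    rw [← div_eq_mul_inv, div_le_iff₀ hd] at h4
    linarith
  have hz0 : meromorphicOrderAt f z = 0 := by
    by_contra h
    exact (hsph z h).1 hz
  have hw0 : meromorphicOrderAt f w = 0 := by
    by_contra h
    have h1 := hsep w (by linarith) h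
    have h2 : |r - ‖w‖| ≤ ρ := by
      rw [← hz, abs_sub_comm]
      exact (abs_norm_sub_norm_le w z).trans hwz
    exact (hsph w h).1 (by
      have : |r - ‖w‖| = 0 := le_antisymm (by linarith) (abs_nonneg _)
      linarith [abs_eq_zero.1 this])
  refine ⟨hw0, ?_⟩
  have hsph' : ∀ u ∈ sphere (0 : ℂ) (2 * r), meromorphicOrderAt f u = 0 := by
    intro u hu
    by_contra h
    exact (hsph u h).2 (by simpa using hu)
  have pw := log_norm_add_sum_log_norm_canonicalFactor hf htop (by positivity) hsph'
    (w := w) (by simp; linarith) hw0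
  have pz := log_norm_add_sum_log_norm_canonicalFactor hf htop (by positivity) hsph'
    (w := z) (by simp; linarith) hz0
  set B := MeromorphicOn.divisor f (ball 0 (2 * r)) with hB
  have hfin : B.support.Finite :=
    MeromorphicOn.divisor_ball_support_finite (hm.meromorphicOn)
  have hBi (i : ℂ) (hi : i ∈ hfin.toFinset) : ‖i‖ < 2 * r ∧ meromorphicOrderAt f i ≠ 0 ∧
      B i = MeromorphicOn.divisor f univ i := by
    have hi' : B i ≠ 0 := by simpa using hi
    have hib : i ∈ ball (0 : ℂ) (2 * r) := B.supportWithinDomain hi'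
    have he : B i = MeromorphicOn.divisor f univ i := by
      rw [hD, hB, MeromorphicOn.divisor_apply hm.meromorphicOn hib]
    exact ⟨by simpa using hib, mt (hD0 i).2 (he ▸ hi'), he⟩
  have fs (x : ℂ) : ∑ᶠ i, (B i : ℝ) * Real.log ‖canonicalFactor (2 * r) i x‖
      = ∑ i ∈ hfin.toFinset, (B i : ℝ) * Real.log ‖canonicalFactor (2 * r) i x‖ := by
    refine finsum_eq_sum_of_support_subset _ fun i hi ↦ ?_
    simp only [Function.mem_support] at hi
    simp only [Finite.coe_toFinset, Function.mem_support]
    intro h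
    simp [h] at hi
  rw [fs] at pw pz
  have hsum : |∑ i ∈ hfin.toFinset, (B i : ℝ) * Real.log ‖canonicalFactor (2 * r) i w‖
      - ∑ i ∈ hfin.toFinset, (B i : ℝ) * Real.log ‖canonicalFactor (2 * r) i z‖| ≤ 2 := by
    rw [← Finset.sum_sub_distrib]
    calc _ ≤ ∑ i ∈ hfin.toFinset, 4 * ρ *
          (|(MeromorphicOn.divisor f univ i : ℝ)| * |r - ‖i‖|⁻¹) := by
          refine (Finset.abs_sum_le_sum_abs _ _).trans (Finset.sum_le_sum fun i hi ↦ ?_)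
          obtain ⟨h1, h2, h3⟩ := hBi i hi
          rw [← mul_sub, abs_mul, h3]
          calc _ ≤ |(MeromorphicOn.divisor f univ i : ℝ)| * (4 * ρ * |r - ‖i‖|⁻¹) := by
                gcongr
                exact abs_log_norm_canonicalFactor_sub_le hr0 hz h1 (hsph i h2).1 hwz hρ
                  (hsep i h1 h2)
            _ = _ := by ring
      _ ≤ 4 * ρ * S := by
          rw [← Finset.mul_sum]
          gcongr
          exact hS _ fun i hi ↦ (hBi i hi).1
      _ ≤ 2 := by linarith
  have havg := (abs_circleAverage_herglotz_sub_le hm (R := 2 * r) (w := w) (z := z)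
    (by linarith) (by linarith)).trans (mul_le_mul_of_nonneg_left
      (circleAverage_abs_log_norm_le hm (by linarith)) (by
        have : 0 ≤ 2 * r - ‖w‖ := by linarith
        have : 0 ≤ 2 * r - ‖z‖ := by linarith
        positivity))
  have hker : 2 * (2 * r) * ‖w - z‖ / ((2 * r - ‖w‖) * (2 * r - ‖z‖)) ≤ 8 * (ρ / r) := by
    calc _ ≤ 2 * (2 * r) * ρ / ((r / 2) * r) := by
          gcongr <;> linarith
      _ = _ := by field_simp; ring
  have hT : 0 ≤ ValueDistribution.characteristic f ⊤ (2 * r)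
      + ValueDistribution.characteristic f⁻¹ ⊤ (2 * r) :=
    add_nonneg (ValueDistribution.characteristic_nonneg (by linarith))
      (ValueDistribution.characteristic_nonneg (by linarith))
  have havg' := (le_abs_self _).trans (havg.trans (mul_le_mul_of_nonneg_right hker hT))
  rw [pw, pz] at havg'
  have := (abs_le.1 hsum).1
  linarith

/-! ### Convergence of `∑ m T ^ (-τ)` from growth of the counting function. -/

/-- By scaling the integral is comparable to `T ^ (-τ)`; the part over `(2T, 3T]`, where `log (r /
T) ≥ log 2`, suffices. -/
theorem le_lintegral_log_div_mul_rpow {T : ℝ} (hT : 1 ≤ T) {τ : ℝ} (hτ : 0 < τ) :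
    ENNReal.ofReal (Real.log 2 * 3 ^ (-τ - 1)) * ENNReal.ofReal (T ^ (-τ)) ≤
      ∫⁻ r in Ioi 1, ENNReal.ofReal (Real.log (r / T)) * ENNReal.ofReal (r ^ (-τ - 1)) := by
  have hT0 : 0 < T := by linarith
  have hlog : 0 < Real.log 2 := Real.log_pos one_lt_two
  calc _ = ∫⁻ _ in Ioc (2 * T) (3 * T),
        ENNReal.ofReal (Real.log 2) * ENNReal.ofReal ((3 * T) ^ (-τ - 1)) := by
        rw [setLIntegral_const, Real.volume_Ioc, ← ENNReal.ofReal_mul (by positivity),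
          ← ENNReal.ofReal_mul (by positivity), ← ENNReal.ofReal_mul (by positivity),
          Real.mul_rpow (by norm_num) hT0.le, Real.rpow_sub_one hT0.ne']
        congr 1
        field_simp
        ring
    _ ≤ ∫⁻ r in Ioc (2 * T) (3 * T),
        ENNReal.ofReal (Real.log (r / T)) * ENNReal.ofReal (r ^ (-τ - 1)) := by
        refine setLIntegral_mono' measurableSet_Ioc fun r hr ↦ ?_
        have hr0 : 0 < r := by linarith [hr.1]
        refine mul_le_mul' (ENNReal.ofReal_le_ofReal ?_) (ENNReal.ofReal_le_ofReal ?_)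
        · exact Real.log_le_log two_pos ((le_div_iff₀ hT0).2 hr.1.le)
        · exact Real.rpow_le_rpow_of_nonpos hr0 hr.2 (by linarith)
    _ ≤ _ := lintegral_mono_set fun r hr ↦ by
        have := hr.1
        simp only [mem_Ioi]
        linarith

/-- Integrate the counting bound against `r ^ (-τ - 1)`: the right side converges because `τ' < τ`,
and by Tonelli the left side dominates a multiple of the series. -/
theorem tsum_mul_rpow_neg_ne_top {ι : Type*} [Countable ι] {m T : ι → ℝ} (hm : ∀ i, 0 ≤ m i)
    (hT : ∀ i, 1 ≤ T i) {N : ℝ → ℝ} {C τ τ' : ℝ} (hτ : 0 < τ) (hτ' : τ' < τ)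
    (hN : ∀ r > 1, ∑' i, ENNReal.ofReal (m i * Real.log (r / T i)) ≤ ENNReal.ofReal (N r))
    (hC : ∀ r > 1, N r ≤ C * r ^ τ') :
    ∑' i, ENNReal.ofReal (m i * T i ^ (-τ)) ≠ ⊤ := by
  set c : ℝ≥0∞ := ENNReal.ofReal (Real.log 2 * 3 ^ (-τ - 1)) with hc
  have hc0 : c ≠ 0 := by
    have hlog : 0 < Real.log 2 := Real.log_pos one_lt_two
    rw [hc, Ne, ENNReal.ofReal_eq_zero, not_le]
    positivity
  have key : c * ∑' i, ENNReal.ofReal (m i * T i ^ (-τ))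
      ≤ ∫⁻ r in Ioi 1, ENNReal.ofReal (C * r ^ (τ' - τ - 1)) := by
    calc c * ∑' i, ENNReal.ofReal (m i * T i ^ (-τ))
        = ∑' i, ENNReal.ofReal (m i) * (c * ENNReal.ofReal (T i ^ (-τ))) := by
          rw [← ENNReal.tsum_mul_left]
          refine tsum_congr fun i ↦ ?_
          rw [ENNReal.ofReal_mul (hm i), mul_left_comm]
      _ ≤ ∑' i, ENNReal.ofReal (m i) * ∫⁻ r in Ioi 1,
            ENNReal.ofReal (Real.log (r / T i)) * ENNReal.ofReal (r ^ (-τ - 1)) := by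
          gcongr with i
          exact le_lintegral_log_div_mul_rpow (hT i) hτ
      _ = ∫⁻ r in Ioi 1, ∑' i, ENNReal.ofReal (m i) *
            (ENNReal.ofReal (Real.log (r / T i)) * ENNReal.ofReal (r ^ (-τ - 1))) := by
          rw [lintegral_tsum fun i ↦ by fun_prop]
          refine tsum_congr fun i ↦ ?_
          rw [lintegral_const_mul]
          fun_prop
      _ ≤ _ := by
          refine setLIntegral_mono' measurableSet_Ioi fun r hr ↦ ?_
          have hr0 : (0 : ℝ) < r := zero_lt_one.trans hr
          calc _ = (∑' i, ENNReal.ofReal (m i * Real.log (r / T i)))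
                * ENNReal.ofReal (r ^ (-τ - 1)) := by
                rw [← ENNReal.tsum_mul_right]
                refine tsum_congr fun i ↦ ?_
                rw [ENNReal.ofReal_mul (hm i), mul_assoc]
            _ ≤ ENNReal.ofReal (C * r ^ τ') * ENNReal.ofReal (r ^ (-τ - 1)) := by
                gcongr
                exact (hN r hr).trans (ENNReal.ofReal_le_ofReal (hC r hr))
            _ = _ := by
                rw [← ENNReal.ofReal_mul' (by positivity), mul_assoc, ← Real.rpow_add hr0]
                ring_nf
  have hfin : ∫⁻ r in Ioi (1 : ℝ), ENNReal.ofReal (C * r ^ (τ' - τ - 1)) < ⊤ := by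
    have : IntegrableOn (fun r : ℝ ↦ C * r ^ (τ' - τ - 1)) (Ioi 1) :=
      (integrableOn_Ioi_rpow_of_lt (by linarith) zero_lt_one).const_mul C
    exact (lintegral_mono fun r ↦ Real.ofReal_le_enorm _).trans_lt this.2
  intro h
  rw [h, ENNReal.mul_top hc0] at key
  exact absurd (key.trans_lt hfin) (lt_irrefl _)

/-! ### The exceptional set of radii. -/

theorem lintegral_Icc_inv_rpow {A p : ℝ} (hA : 0 ≤ A) (hp : p < 1) :
    ∫⁻ x in Icc 0 A, ENNReal.ofReal (x⁻¹ ^ p) = ENNReal.ofReal (A ^ (1 - p) / (1 - p)) := by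
  have h1 : IntervalIntegrable (fun x : ℝ ↦ x ^ (-p)) volume 0 A :=
    intervalIntegral.intervalIntegrable_rpow' (by linarith)
  have h2 := integral_rpow (a := 0) (b := A) (r := -p) (Or.inl (by linarith))
  rw [Real.zero_rpow (by linarith), sub_zero, intervalIntegral.integral_of_le hA] at h2
  rw [setLIntegral_congr Ioc_ae_eq_Icc.symm, show 1 - p = -p + 1 by ring, ← h2,
    ofReal_integral_eq_lintegral_ofReal ((intervalIntegrable_iff_integrableOn_Ioc_of_le hA).1 h1)]
  · refine setLIntegral_congr_fun measurableSet_Ioc fun x hx ↦ ?_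
    rw [Real.inv_rpow hx.1.le, Real.rpow_neg hx.1.le]
  · filter_upwards [self_mem_ae_restrict measurableSet_Ioc] with x hx
    exact Real.rpow_nonneg hx.1.le _

theorem lintegral_inv_abs_sub_rpow_le {A p t : ℝ} (hA : 0 ≤ A) (hp : p < 1) :
    ∫⁻ r in Icc (t - A) (t + A), ENNReal.ofReal (|r - t|⁻¹ ^ p)
      ≤ ENNReal.ofReal (2 * (A ^ (1 - p) / (1 - p))) := by
  have h1 : ∫⁻ r in (fun r ↦ r - t) ⁻¹' Icc 0 A, ENNReal.ofReal (|r - t|⁻¹ ^ p)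
      = ENNReal.ofReal (A ^ (1 - p) / (1 - p)) := by
    rw [← lintegral_Icc_inv_rpow hA hp, (measurePreserving_sub_right volume t).setLIntegral_comp_preimage_emb
      (MeasurableEquiv.subRight t).measurableEmbedding (fun x ↦ ENNReal.ofReal (|x|⁻¹ ^ p))]
    refine setLIntegral_congr_fun measurableSet_Icc fun x hx ↦ ?_
    simp only [abs_of_nonneg hx.1]
  have h2 : ∫⁻ r in (fun r ↦ t - r) ⁻¹' Icc 0 A, ENNReal.ofReal (|r - t|⁻¹ ^ p)
      = ENNReal.ofReal (A ^ (1 - p) / (1 - p)) := by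
    simp_rw [abs_sub_comm _ t]
    rw [← lintegral_Icc_inv_rpow hA hp, (Measure.measurePreserving_sub_left volume t).setLIntegral_comp_preimage_emb
      (MeasurableEquiv.subLeft t).measurableEmbedding (fun x ↦ ENNReal.ofReal (|x|⁻¹ ^ p))]
    refine setLIntegral_congr_fun measurableSet_Icc fun x hx ↦ ?_
    simp only [abs_of_nonneg hx.1]
  calc _ ≤ ∫⁻ r in ((fun r ↦ r - t) ⁻¹' Icc 0 A) ∪ ((fun r ↦ t - r) ⁻¹' Icc 0 A),
        ENNReal.ofReal (|r - t|⁻¹ ^ p) := by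
        refine lintegral_mono_set fun r hr ↦ ?_
        rcases le_total t r with h | h
        · left; exact ⟨by linarith, by linarith [hr.2]⟩
        · right; exact ⟨by linarith, by linarith [hr.1]⟩
    _ ≤ _ := lintegral_union_le _ _ _
    _ = _ := by
        rw [h1, h2, two_mul, ENNReal.ofReal_add] <;>
        exact div_nonneg (by positivity) (by linarith)

/-- Up to `2T` the weight is bounded by a multiple of `T ^ (p - τ - 1)` and the singularity is
integrable because `p < 1`. Beyond `2T`, `|r - t| ≥ r / 2` reduces the integrand to `r ^ (-τ - 1)`.
-/
theorem lintegral_inv_abs_sub_rpow_mul_rpow_le {p τ : ℝ} (hp0 : 0 < p) (hp1 : p < 1)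
    (hτ : 0 < τ) {t : ℝ} (ht : 0 ≤ t) :
    ∫⁻ r in Ioi (max t 1 / 2), ENNReal.ofReal (|r - t|⁻¹ ^ p) * ENNReal.ofReal (r ^ (p - τ - 1))
      ≤ ENNReal.ofReal (2 * (2 ^ (1 - p) / (1 - p)) * (1 / 2) ^ (p - τ - 1)
          + 2 ^ p * (2 ^ (-τ) / τ)) * ENNReal.ofReal (max t 1 ^ (-τ)) := by
  set T := max t 1 with hTdef
  have hT0 : 0 < T := lt_max_of_lt_right one_pos
  have htT : t ≤ T := le_max_left _ _
  have hp1' : 0 < 1 - p := by linarith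
  have near : ∫⁻ r in Ioc (T / 2) (2 * T),
      ENNReal.ofReal (|r - t|⁻¹ ^ p) * ENNReal.ofReal (r ^ (p - τ - 1))
      ≤ ENNReal.ofReal (2 * (2 ^ (1 - p) / (1 - p)) * (1 / 2) ^ (p - τ - 1) * T ^ (-τ)) := by
    calc _ ≤ ∫⁻ r in Ioc (T / 2) (2 * T),
          ENNReal.ofReal (|r - t|⁻¹ ^ p) * ENNReal.ofReal ((T / 2) ^ (p - τ - 1)) := by
          refine setLIntegral_mono' measurableSet_Ioc fun r hr ↦ ?_
          refine mul_le_mul_right (ENNReal.ofReal_le_ofReal ?_) _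
          exact Real.rpow_le_rpow_of_nonpos (by positivity) hr.1.le (by linarith)
      _ ≤ ∫⁻ r in Icc (t - 2 * T) (t + 2 * T),
          ENNReal.ofReal (|r - t|⁻¹ ^ p) * ENNReal.ofReal ((T / 2) ^ (p - τ - 1)) :=
          lintegral_mono_set fun r hr ↦ ⟨by linarith [hr.1], by linarith [hr.2]⟩
      _ ≤ ENNReal.ofReal (2 * ((2 * T) ^ (1 - p) / (1 - p)))
            * ENNReal.ofReal ((T / 2) ^ (p - τ - 1)) := by
          rw [lintegral_mul_const _ (by fun_prop)]
          gcongr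
          exact lintegral_inv_abs_sub_rpow_le (by positivity) hp1
      _ = _ := by
          rw [← ENNReal.ofReal_mul (by positivity), Real.mul_rpow (by norm_num) hT0.le,
            div_eq_mul_one_div T 2, Real.mul_rpow hT0.le (by norm_num),
            show -τ = (1 - p) + (p - τ - 1) by ring, Real.rpow_add hT0]
          congr 1
          ring
  have far : ∫⁻ r in Ioi (2 * T),
      ENNReal.ofReal (|r - t|⁻¹ ^ p) * ENNReal.ofReal (r ^ (p - τ - 1))
      ≤ ENNReal.ofReal (2 ^ p * (2 ^ (-τ) / τ) * T ^ (-τ)) := by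
    calc _ ≤ ∫⁻ r in Ioi (2 * T), ENNReal.ofReal (2 ^ p * r ^ (-τ - 1)) := by
          refine setLIntegral_mono' measurableSet_Ioi fun r hr ↦ ?_
          have hr' : 2 * T < r := hr
          have hr0 : 0 < r := by linarith
          have h1 : r / 2 ≤ |r - t| := by
            rw [abs_of_nonneg (by linarith)]; linarith
          rw [← ENNReal.ofReal_mul (by positivity)]
          refine ENNReal.ofReal_le_ofReal ?_
          calc |r - t|⁻¹ ^ p * r ^ (p - τ - 1) ≤ (r / 2)⁻¹ ^ p * r ^ (p - τ - 1) := by gcongr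
            _ = _ := by
              rw [inv_div, Real.div_rpow (by norm_num) hr0.le, show p - τ - 1 = p + (-τ - 1) by ring,
                Real.rpow_add hr0]
              field_simp
      _ = ENNReal.ofReal (∫ r in Ioi (2 * T), 2 ^ p * r ^ (-τ - 1)) := by
          rw [ofReal_integral_eq_lintegral_ofReal]
          · exact (integrableOn_Ioi_rpow_of_lt (by linarith) (by positivity)).const_mul _
          · filter_upwards [self_mem_ae_restrict measurableSet_Ioi] with x hx
            have : (0 : ℝ) < x := lt_trans (by positivity) hx
            positivity
      _ = _ := by
          rw [integral_const_mul, integral_Ioi_rpow_of_lt (by linarith) (by positivity),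
            show -τ - 1 + 1 = -τ by ring, Real.mul_rpow (by norm_num) hT0.le]
          congr 1
          field_simp
  have hun : Ioi (T / 2) = Ioc (T / 2) (2 * T) ∪ Ioi (2 * T) :=
    (Ioc_union_Ioi_eq_Ioi (by linarith)).symm
  rw [hun]
  refine (lintegral_union_le _ _ _).trans ((add_le_add near far).trans ?_)
  rw [← ENNReal.ofReal_add (by positivity) (by positivity), ← ENNReal.ofReal_mul (by positivity),
    ← add_mul]

/-- Weights at least one force each `x i ≤ A ^ (1 / p)`; then split `x = x ^ p * x ^ (1 - p)` and
bound the second factor. -/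
theorem sum_mul_le_rpow_of_sum_mul_rpow_le {ι : Type*} {s : Finset ι} {a x : ι → ℝ} {A p : ℝ}
    (ha : ∀ i ∈ s, 1 ≤ a i) (hx : ∀ i ∈ s, 0 ≤ x i) (hp0 : 0 < p) (hp1 : p < 1) (hA : 0 < A)
    (h : ∑ i ∈ s, a i * x i ^ p ≤ A) :
    ∑ i ∈ s, a i * x i ≤ A ^ (1 / p) := by
  have hterm (i) (hi : i ∈ s) : x i ≤ A ^ (1 / p) := by
    have h1 : x i ^ p ≤ A := by
      refine le_trans ?_ ((Finset.single_le_sum (f := fun i ↦ a i * x i ^ p) (fun j hj ↦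
        mul_nonneg (by linarith [ha j hj]) (Real.rpow_nonneg (hx j hj) _)) hi).trans h)
      exact le_mul_of_one_le_left (Real.rpow_nonneg (hx i hi) _) (ha i hi)
    calc x i = (x i ^ p) ^ (1 / p) := by
          rw [← Real.rpow_mul (hx i hi), mul_one_div_cancel hp0.ne', Real.rpow_one]
      _ ≤ _ := Real.rpow_le_rpow (Real.rpow_nonneg (hx i hi) _) h1 (by positivity)
  calc _ ≤ ∑ i ∈ s, a i * x i ^ p * (A ^ (1 / p)) ^ (1 - p) := by
        refine Finset.sum_le_sum fun i hi ↦ ?_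
        have h1 : x i = x i ^ p * x i ^ (1 - p) := by
          rw [← Real.rpow_add_of_nonneg (hx i hi) hp0.le (by linarith)]
          simp
        rw [mul_assoc]
        refine mul_le_mul_of_nonneg_left ?_ (by linarith [ha i hi])
        nth_rewrite 1 [h1]
        exact mul_le_mul_of_nonneg_left (Real.rpow_le_rpow (hx i hi) (hterm i hi) (by linarith))
          (Real.rpow_nonneg (hx i hi) _)
    _ ≤ A * (A ^ (1 / p)) ^ (1 - p) := by
        rw [← Finset.sum_mul]
        gcongr
    _ = _ := by
        rw [← Real.rpow_mul hA.le, ← Real.rpow_one_add' hA.le]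
        · congr 1; field_simp; ring
        · have : 1 / p * (1 - p) = 1 / p - 1 := by field_simp
          rw [this]; simp [hp0.ne']

/-- If the points `t i` have exponent of convergence less than `τ`, then `∑ 1 / |r - t i|` is at
most `r ^ (τ / p - 1)` outside a set of radii `r` of finite logarithmic measure. -/
theorem exists_sum_inv_abs_sub_le {ι : Type*} [Countable ι] {m t : ι → ℝ} (hm : ∀ i, 1 ≤ m i)
    (ht : ∀ i, 0 ≤ t i) {p τ : ℝ} (hp0 : 0 < p) (hp1 : p < 1) (hτ : 0 < τ)
    (hsum : ∑' i, ENNReal.ofReal (m i * max (t i) 1 ^ (-τ)) ≠ ⊤) :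
    ∃ E ⊆ Ioi (1 : ℝ), MeasurableSet E ∧ logarithmicMeasure E < ⊤ ∧
      ∀ r > 1, r ∉ E → ∀ s : Finset ι, (∀ i ∈ s, t i < 2 * r) →
        ∑ i ∈ s, m i * |r - t i|⁻¹ ≤ r ^ (τ / p - 1) := by
  -- The cutoff retains every point with `t i < 2 * r` when `r > 1`, and keeps the weight away from
  -- its singularity at `0`.
  set G : ι → ℝ → ℝ≥0∞ := fun i ↦
    (Ioi (max (t i) 1 / 2)).indicator fun r ↦ ENNReal.ofReal (m i * |r - t i|⁻¹ ^ p) with hG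
  set F : ℝ → ℝ≥0∞ := fun r ↦ ∑' i, G i r with hF
  have hGm (i) : Measurable (G i) :=
    Measurable.indicator (by fun_prop) measurableSet_Ioi
  have hFm : Measurable F := Measurable.tsum hGm
  have hint : ∫⁻ r in Ioi 1, F r * ENNReal.ofReal (r ^ (p - τ - 1)) < ⊤ := by
    set K := ENNReal.ofReal (2 * (2 ^ (1 - p) / (1 - p)) * (1 / 2) ^ (p - τ - 1)
          + 2 ^ p * (2 ^ (-τ) / τ)) with hK
    calc _ = ∑' i, ∫⁻ r in Ioi 1, G i r * ENNReal.ofReal (r ^ (p - τ - 1)) := by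
          simp_rw [hF, ← ENNReal.tsum_mul_right]
          exact lintegral_tsum fun i ↦ ((hGm i).mul (by fun_prop)).aemeasurable
      _ ≤ ∑' i, K * ENNReal.ofReal (m i * max (t i) 1 ^ (-τ)) := by
          refine ENNReal.tsum_le_tsum fun i ↦ ?_
          have hmi : 0 ≤ m i := by linarith [hm i]
          calc _ ≤ ∫⁻ r, G i r * ENNReal.ofReal (r ^ (p - τ - 1)) := setLIntegral_le_lintegral _ _
            _ = ENNReal.ofReal (m i) * ∫⁻ r in Ioi (max (t i) 1 / 2),
                  ENNReal.ofReal (|r - t i|⁻¹ ^ p) * ENNReal.ofReal (r ^ (p - τ - 1)) := by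
                rw [← lintegral_const_mul _ (by fun_prop), ← lintegral_indicator measurableSet_Ioi]
                congr 1
                ext r
                by_cases hr : r ∈ Ioi (max (t i) 1 / 2)
                · simp only [hG, indicator_of_mem hr, ENNReal.ofReal_mul hmi, mul_assoc]
                · simp only [hG, indicator_of_notMem hr, zero_mul]
            _ ≤ ENNReal.ofReal (m i) * (K * ENNReal.ofReal (max (t i) 1 ^ (-τ))) := by
                gcongr
                exact lintegral_inv_abs_sub_rpow_mul_rpow_le hp0 hp1 hτ (ht i)
            _ = _ := by rw [ENNReal.ofReal_mul hmi, mul_left_comm]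
      _ < ⊤ := by
          rw [ENNReal.tsum_mul_left]
          exact ENNReal.mul_lt_top ENNReal.ofReal_lt_top hsum.lt_top
  -- Markov's inequality: on this set `1 / r = r ^ (τ - p) * r ^ (p - τ - 1)` is at most the
  -- integrable function of `hint`.
  refine ⟨{r | ENNReal.ofReal (r ^ (τ - p)) < F r} ∩ Ioi 1, inter_subset_right,
    (measurableSet_lt (by fun_prop) hFm).inter measurableSet_Ioi, ?_, ?_⟩
  · refine lt_of_le_of_lt ?_ hint
    rw [logarithmicMeasure]
    refine (setLIntegral_mono' (((measurableSet_lt (by fun_prop) hFm).inter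
      measurableSet_Ioi).inter measurableSet_Ioi) fun r hr ↦ ?_).trans
      (lintegral_mono_set inter_subset_right)
    have hr0 : (0 : ℝ) < r := zero_lt_one.trans hr.2
    calc ENNReal.ofReal (1 / r) = ENNReal.ofReal (r ^ (τ - p)) * ENNReal.ofReal (r ^ (p - τ - 1)) := by
          rw [← ENNReal.ofReal_mul (by positivity), ← Real.rpow_add hr0,
            show τ - p + (p - τ - 1) = -1 by ring, Real.rpow_neg_one, one_div]
      _ ≤ _ := by
          gcongr
          exact hr.1.1.le
  · intro r hr hrE s hs
    have hr0 : (0 : ℝ) < r := zero_lt_one.trans hr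
    have hFr : F r ≤ ENNReal.ofReal (r ^ (τ - p)) := by
      by_contra h
      exact hrE ⟨not_le.1 h, hr⟩
    have h1 : ∑ i ∈ s, m i * |r - t i|⁻¹ ^ p ≤ r ^ (τ - p) := by
      have hmi (i) : 0 ≤ m i := by linarith [hm i]
      rw [← ENNReal.ofReal_le_ofReal_iff (by positivity),
        ENNReal.ofReal_sum_of_nonneg fun i _ ↦ mul_nonneg (hmi i) (by positivity)]
      refine le_trans ?_ ((ENNReal.sum_le_tsum (f := fun i ↦ G i r) s).trans hFr)
      refine Finset.sum_le_sum fun i hi ↦ ?_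
      have : r ∈ Ioi (max (t i) 1 / 2) := by
        have h2 : max (t i) 1 < 2 * r := max_lt (hs i hi) (by linarith)
        simp only [mem_Ioi]
        linarith
      simp only [hG, indicator_of_mem this, le_refl]
    refine (sum_mul_le_rpow_of_sum_mul_rpow_le (fun i _ ↦ hm i) (fun i _ ↦ by positivity) hp0 hp1
      (by positivity) h1).trans_eq ?_
    rw [← Real.rpow_mul hr0.le]
    congr 1
    field_simp

/-! ### From the order to the zeros and poles. -/

theorem nevanlinnaOrder_nonneg (f : ℂ → ℂ) : 0 ≤ nevanlinnaOrder f := by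
  refine le_limsup_of_frequently_le' (Eventually.frequently ?_)
  filter_upwards [eventually_ge_atTop 1] with r hr
  exact_mod_cast div_nonneg Real.posLog_nonneg (Real.log_nonneg hr)

theorem eventually_characteristic_le_rpow {f : ℂ → ℂ} {β : ℝ}
    (hβ : nevanlinnaOrder f < (β : EReal)) :
    ∀ᶠ r : ℝ in atTop, ValueDistribution.characteristic f ⊤ r ≤ r ^ β := by
  filter_upwards [eventually_lt_of_limsup_lt hβ, eventually_gt_atTop 1] with r h hr
  have hlog := Real.log_pos hr
  have hr0 : 0 < r := by linarith
  rw [EReal.coe_lt_coe_iff, div_lt_iff₀ hlog] at h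
  rcases le_or_gt (ValueDistribution.characteristic f ⊤ r) 0 with h0 | h0
  · exact h0.trans (by positivity)
  · rw [← Real.log_le_log_iff h0 (by positivity), Real.log_rpow hr0]
    exact (le_max_right 0 _).trans h.le

/-- By the first main theorem the two characteristics differ by a bounded amount, absorbed in the
third `r ^ β` since `β > 0`. -/
theorem eventually_characteristic_add_inv_le_rpow {f : ℂ → ℂ} (hf : Meromorphic f) {β : ℝ}
    (hβ : nevanlinnaOrder f < (β : EReal)) :
    ∀ᶠ r : ℝ in atTop, ValueDistribution.characteristic f ⊤ r
      + ValueDistribution.characteristic f⁻¹ ⊤ r ≤ 3 * r ^ β := by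
  have hβ0 : 0 < β := by exact_mod_cast (nevanlinnaOrder_nonneg f).trans_lt hβ
  filter_upwards [eventually_characteristic_le_rpow hβ, (tendsto_rpow_atTop hβ0).eventually_ge_atTop
    (max |Real.log ‖f 0‖| |Real.log ‖meromorphicTrailingCoeffAt f 0‖|)] with r h1 h2
  have h3 := (abs_le.1 ((ValueDistribution.characteristic_sub_characteristic_inv_le hf (R := r)).trans h2)).1
  linarith

namespace Function.locallyFinsuppWithin

theorem sum_mul_log_le_logCounting {A : Function.locallyFinsupp ℂ ℤ} (hA : 0 ≤ A) {r : ℝ}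
    (hr : 1 ≤ r) (s : Finset ℂ) (hs : ∀ i ∈ s, ‖i‖ ≤ r) :
    ∑ i ∈ s, (A i : ℝ) * (Real.log r - Real.log ‖i‖) ≤ logCounting A r := by
  classical
  have hle : ∑ i ∈ s, single i (A i) ≤ A := by
    intro x
    simp only [coe_sum, Finset.sum_apply, single_apply, Finset.sum_ite_eq]
    split_ifs
    · rfl
    · exact hA x
  refine le_trans (le_of_eq ?_) (logCounting_le hle hr)
  rw [map_sum, Finset.sum_apply]
  exact Finset.sum_congr rfl fun i hi ↦ (logCounting_single_eq_log_sub_const (hs i hi)).symm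

theorem countable_support (D : Function.locallyFinsupp ℂ ℤ) : D.support.Countable := by
  refine (countable_iUnion fun n : ℕ ↦ ((Function.locallyFinsupp.locallyFiniteSupport
    D).finite_inter_support_of_isCompact (isCompact_closedBall (0 : ℂ) n)).countable).mono ?_
  intro x hx
  obtain ⟨n, hn⟩ := exists_nat_ge ‖x‖
  exact mem_iUnion.2 ⟨n, by simpa using hn, hx⟩

theorem tsum_mul_log_le_logCounting {A : Function.locallyFinsupp ℂ ℤ} (hA : 0 ≤ A) {r : ℝ}
    (hr : 1 < r) (S : Set ℂ) :
    ∑' i : S, ENNReal.ofReal ((A i : ℝ) * Real.log (r / max ‖(i : ℂ)‖ 1))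
      ≤ ENNReal.ofReal (logCounting A r) := by
  refine ENNReal.summable.tsum_le_of_sum_le fun s ↦ ?_
  have hr0 : 0 < r := by linarith
  have hA' (i : ℂ) : (0 : ℝ) ≤ A i := by exact_mod_cast hA i
  set s' := (s.map (Function.Embedding.subtype (· ∈ S))).filter (‖·‖ ≤ r) with hs'
  calc ∑ i ∈ s, ENNReal.ofReal ((A i : ℝ) * Real.log (r / max ‖(i : ℂ)‖ 1))
      = ∑ i ∈ s.map (Function.Embedding.subtype (· ∈ S)),
          ENNReal.ofReal ((A i : ℝ) * Real.log (r / max ‖i‖ 1)) := by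
        rw [Finset.sum_map]; rfl
    _ = ∑ i ∈ s', ENNReal.ofReal ((A i : ℝ) * Real.log (r / max ‖i‖ 1)) := by
        refine (Finset.sum_filter_of_ne fun i _ hi ↦ ?_).symm
        by_contra h
        refine hi (ENNReal.ofReal_of_nonpos (mul_nonpos_of_nonneg_of_nonpos (hA' i)
          (Real.log_nonpos (by positivity) ?_)))
        rw [div_le_one (by positivity)]
        exact (not_le.1 h).le.trans (le_max_left _ _)
    _ ≤ ∑ i ∈ s', ENNReal.ofReal ((A i : ℝ) * (Real.log r - Real.log ‖i‖)) := by
        refine Finset.sum_le_sum fun i _ ↦ ENNReal.ofReal_le_ofReal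
          (mul_le_mul_of_nonneg_left ?_ (hA' i))
        rw [Real.log_div hr0.ne' (by positivity)]
        refine sub_le_sub_left ?_ _
        rcases eq_or_ne ‖i‖ 0 with h | h
        · simp [h]
        · exact Real.log_le_log (by positivity) (le_max_left _ _)
    _ = ENNReal.ofReal (∑ i ∈ s', (A i : ℝ) * (Real.log r - Real.log ‖i‖)) := by
        refine (ENNReal.ofReal_sum_of_nonneg fun i hi ↦ mul_nonneg (hA' i) ?_).symm
        rcases eq_or_ne ‖i‖ 0 with h | h
        · simpa [h] using Real.log_nonneg hr.le
        · exact sub_nonneg.2 (Real.log_le_log (by positivity) (Finset.mem_filter.1 hi).2)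
    _ ≤ _ := ENNReal.ofReal_le_ofReal (sum_mul_log_le_logCounting hA hr.le _ fun i hi ↦
        (Finset.mem_filter.1 hi).2)

end Function.locallyFinsuppWithin

theorem tsum_abs_divisor_mul_rpow_ne_top {f : ℂ → ℂ} (hf : Meromorphic f) {τ : ℝ}
    (hτ : nevanlinnaOrder f < (τ : EReal)) :
    ∑' i : (MeromorphicOn.divisor f univ).support,
      ENNReal.ofReal (|(MeromorphicOn.divisor f univ i : ℝ)| * max ‖(i : ℂ)‖ 1 ^ (-τ)) ≠ ⊤ := by
  obtain ⟨τ', h1, h2⟩ := EReal.lt_iff_exists_real_btwn.1 hτ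
  rw [EReal.coe_lt_coe_iff] at h2
  have hτ0 : 0 < τ' := by exact_mod_cast (nevanlinnaOrder_nonneg f).trans_lt h1
  set D := MeromorphicOn.divisor f univ with hD
  set A : Function.locallyFinsupp ℂ ℤ := D⁺ + D⁻ with hAdef
  have hA : 0 ≤ A := add_nonneg (posPart_nonneg D) (negPart_nonneg D)
  have hAD (i : ℂ) : (A i : ℝ) = |(D i : ℝ)| := by
    rw [← Int.cast_abs, ← posPart_add_negPart (D i)]
    rfl
  have hAN (r : ℝ) (hr : 1 ≤ r) : Function.locallyFinsuppWithin.logCounting A r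
      ≤ ValueDistribution.characteristic f ⊤ r + ValueDistribution.characteristic f⁻¹ ⊤ r := by
    simp only [hAdef, map_add, Pi.add_apply, ValueDistribution.characteristic]
    rw [ValueDistribution.logCounting_inv, ValueDistribution.logCounting_top,
      ValueDistribution.logCounting_zero, ← hD]
    have h1 := ValueDistribution.proximity_nonneg (f := f) (a := ⊤) r
    have h2 := ValueDistribution.proximity_nonneg (f := f⁻¹) (a := ⊤) r
    simp only [Pi.zero_apply] at h1 h2
    linarith
  obtain ⟨R, hR⟩ := eventually_atTop.1 ((eventually_characteristic_add_inv_le_rpow hf h1).and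
    (eventually_ge_atTop 1))
  have hR1 := (hR R le_rfl).2
  have := (Function.locallyFinsuppWithin.countable_support D).to_subtype
  have key := tsum_mul_rpow_neg_ne_top (ι := D.support) (m := fun i ↦ (A i : ℝ))
    (T := fun i ↦ max ‖(i : ℂ)‖ 1) (fun i ↦ by exact_mod_cast hA i) (fun i ↦ le_max_right _ _)
    (N := Function.locallyFinsuppWithin.logCounting A)
    -- The growth bound holds only from `R` on; below `R`, monotonicity gives the value at `R`, and
    -- `r ^ τ' ≥ 1`.
    (C := max 3 (Function.locallyFinsuppWithin.logCounting A R)) (hτ0.trans h2) h2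
    (fun r hr ↦ Function.locallyFinsuppWithin.tsum_mul_log_le_logCounting hA hr _) (fun r hr ↦ by
      have hr0 : 0 < r := zero_lt_one.trans hr
      rcases le_total R r with h | h
      · refine (hAN r hr.le).trans ((hR r h).1.trans ?_)
        gcongr
        exact le_max_left _ _
      · refine (Function.locallyFinsuppWithin.logCounting_mono hA hr0
          (show R ∈ Ioi (0 : ℝ) from hr0.trans_le h) h).trans ((le_max_right 3 _).trans ?_)
        exact le_mul_of_one_le_right (by positivity) (Real.one_le_rpow hr.le hτ0.le))
  simpa only [hAD] using key

/-! ### Assembling the estimate. -/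

theorem logarithmicMeasure_union_le (E F : Set ℝ) :
    logarithmicMeasure (E ∪ F) ≤ logarithmicMeasure E + logarithmicMeasure F := by
  rw [logarithmicMeasure, union_inter_distrib_right]
  exact lintegral_union_le _ _ _

theorem logarithmicMeasure_of_countable {E : Set ℝ} (hE : E.Countable) :
    logarithmicMeasure E = 0 :=
  setLIntegral_measure_zero _ _ ((hE.mono inter_subset_left).measure_zero _)

/-- The comparison of the difference quotient with the logarithmic derivative, for meromorphic
functions in normal form. -/
theorem MeromorphicNFOn.exists_norm_fwdDiff_div_sub_le {f : ℂ → ℂ} (hf : MeromorphicNFOn f univ)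
    (htop : ∀ u, meromorphicOrderAt f u ≠ ⊤) {σ : ℝ} (hσ : nevanlinnaOrder f = (σ : EReal))
    (hσ1 : σ < 1) (η : ℂ) {ε : ℝ} (hε : 0 < ε) :
    ∃ E ⊆ Ioi (1 : ℝ), MeasurableSet E ∧ logarithmicMeasure E < ⊤ ∧
      ∃ K > (0 : ℝ), ∃ r₀ > (0 : ℝ), ∀ z : ℂ, ‖z‖ ∉ E ∪ Icc 0 1 → r₀ < ‖z‖ →
        ‖fwdDiff η f z / f z - η * (deriv f z / f z)‖ ≤ K * ‖z‖ ^ (2 * σ - 2 + ε) := by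
  have hm : Meromorphic f := fun x ↦ (hf (mem_univ x)).meromorphicAt
  have hσ0 : 0 ≤ σ := by exact_mod_cast hσ ▸ nevanlinnaOrder_nonneg f
  obtain ⟨β, hσβ, hβ⟩ := exists_between (lt_min hσ1 (by linarith : σ < σ + ε / 2))
  obtain ⟨hβ1, hβε⟩ := lt_min_iff.1 hβ
  obtain ⟨τ, hστ, hτβ⟩ := exists_between hσβ
  have hτ0 : 0 < τ := by linarith
  have hβ0 : 0 < β := by linarith
  set D := MeromorphicOn.divisor f univ with hD
  have hD0 (i : ℂ) : i ∈ D.support ↔ meromorphicOrderAt f i ≠ 0 := by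
    rw [Function.mem_support, hD, MeromorphicOn.divisor_apply hm.meromorphicOn (mem_univ i), Ne,
      WithTop.untop₀_eq_zero]
    simp [htop i]
  have hcount := Function.locallyFinsuppWithin.countable_support D
  have := hcount.to_subtype
  obtain ⟨E, hE1, hEm, hEfin, hE⟩ := exists_sum_inv_abs_sub_le (ι := D.support)
    (m := fun i ↦ |(D i : ℝ)|) (t := fun i ↦ ‖(i : ℂ)‖) (fun i ↦ by
      rw [← Int.cast_abs]
      exact_mod_cast Int.one_le_abs i.2) (fun i ↦ norm_nonneg _) (div_pos hτ0 hβ0)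
    ((div_lt_one hβ0).2 hτβ) hτ0
    (tsum_abs_divisor_mul_rpow_ne_top hm (by rw [hσ]; exact_mod_cast hστ))
  have hexp : τ / (τ / β) - 1 = β - 1 := by field_simp
  rw [hexp] at hE
  -- Removing these countably many radii keeps zeros and poles off the circles of radius `r` and `2
  -- * r`.
  set B : Set ℝ := (norm '' D.support ∪ (fun i ↦ ‖i‖ / 2) '' D.support) ∩ Ioi 1 with hB
  have hBc : B.Countable := ((hcount.image _).union (hcount.image _)).mono inter_subset_left
  refine ⟨E ∪ B, union_subset hE1 inter_subset_right, hEm.union hBc.measurableSet, ?_, ?_⟩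
  · refine (logarithmicMeasure_union_le E B).trans_lt ?_
    rwa [logarithmicMeasure_of_countable hBc, add_zero]
  have ev1 : ∀ᶠ r : ℝ in atTop, ValueDistribution.characteristic f ⊤ (2 * r)
      + ValueDistribution.characteristic f⁻¹ ⊤ (2 * r) ≤ 3 * (2 * r) ^ β :=
    (tendsto_id.const_mul_atTop two_pos).eventually
      (eventually_characteristic_add_inv_le_rpow hm (by rw [hσ]; exact_mod_cast hσβ))
  have ev2 : ∀ᶠ r : ℝ in atTop, 8 * ‖η‖ < r ^ (1 - β) :=
    (tendsto_rpow_atTop (by linarith)).eventually_gt_atTop _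
  obtain ⟨r₀, hr₀⟩ := eventually_atTop.1 (ev1.and ev2)
  -- `128 = 32 * 4`, as `ρ ^ 2 = r ^ (2 - 2 * β) / 4`; `26 = 2 + 24` collects the zeros and poles
  -- and the boundary integral. The `+ 1` keeps the constant positive when `η = 0`.
  refine ⟨128 * Real.exp 26 * ‖η‖ ^ 2 + 1, by positivity, max r₀ 1, by positivity, ?_⟩
  intro z hz hzr
  set r := ‖z‖ with hr
  have hr1 : 1 < r := (le_max_right _ _).trans_lt hzr
  have hr0 : 0 < r := by linarith
  obtain ⟨hT, hη⟩ := hr₀ r ((le_max_left _ _).trans hzr.le)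
  simp only [mem_union, not_or] at hz
  obtain ⟨⟨hzE, hzB⟩, -⟩ := hz
  have hsph (u : ℂ) (hu : meromorphicOrderAt f u ≠ 0) : ‖u‖ ≠ r ∧ ‖u‖ ≠ 2 * r :=
    ⟨fun h ↦ hzB ⟨Or.inl ⟨u, (hD0 u).2 hu, h⟩, hr1⟩,
      fun h ↦ hzB ⟨Or.inr ⟨u, (hD0 u).2 hu, by simp only [h]; ring⟩, hr1⟩⟩
  have hS (s : Finset ℂ) (hs : ∀ i ∈ s, ‖i‖ < 2 * r) :
      ∑ i ∈ s, |(D i : ℝ)| * |r - ‖i‖|⁻¹ ≤ r ^ (β - 1) := by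
    classical
    refine le_trans (le_of_eq ?_) (hE r hr1 hzE (s.subtype (· ∈ D.support))
      fun i hi ↦ hs i (Finset.mem_subtype.1 hi))
    rw [Finset.sum_subtype_eq_sum_filter (p := (· ∈ D.support))
      (f := fun i ↦ |(D i : ℝ)| * |r - ‖i‖|⁻¹)]
    refine (Finset.sum_filter_of_ne fun i _ hi ↦ ?_).symm
    by_contra h
    exact hi (by simp [Function.notMem_support.1 h])
  set ρ := r ^ (1 - β) / 2 with hρ
  have hρ0 : 0 < ρ := by positivity
  have hρr : ρ ≤ r / 2 := by
    have := Real.rpow_le_rpow_of_exponent_le hr1.le (by linarith : 1 - β ≤ 1)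
    rw [Real.rpow_one] at this
    linarith
  have hρS : ρ * r ^ (β - 1) ≤ 1 / 2 := by
    rw [hρ, div_mul_eq_mul_div, ← Real.rpow_add hr0]
    simp
  have hgrow : 8 * (ρ / r) * (ValueDistribution.characteristic f ⊤ (2 * r)
      + ValueDistribution.characteristic f⁻¹ ⊤ (2 * r)) ≤ 24 := by
    have h2 : (2 : ℝ) ^ β ≤ 2 := by
      simpa using Real.rpow_le_rpow_of_exponent_le one_le_two hβ1.le
    calc _ ≤ 8 * (ρ / r) * (3 * (2 * r ^ β)) := by
          refine mul_le_mul_of_nonneg_left (hT.trans ?_) (by positivity)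
          rw [Real.mul_rpow two_pos.le hr0.le]
          gcongr
      _ = 24 * (r ^ (1 - β) * r ^ β / r) := by rw [hρ]; ring
      _ = 24 := by
          rw [← Real.rpow_add hr0, sub_add_cancel, Real.rpow_one, div_self hr0.ne', mul_one]
  have near (w : ℂ) (hw : w ∈ ball z ρ) :
      meromorphicOrderAt f w = 0 ∧ Real.log ‖f w‖ ≤ Real.log ‖f z‖ + 26 := by
    obtain ⟨h1, h2⟩ := log_norm_le_of_norm_sub_le hf htop hr1.le hsph hr.symm hS
      (mem_ball_iff_norm.1 hw).le hρr hρS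
    exact ⟨h1, by linarith⟩
  have hne (w : ℂ) (hw : w ∈ ball z ρ) : f w ≠ 0 :=
    (hf (mem_univ w)).meromorphicOrderAt_eq_zero_iff.1 (near w hw).1
  have hzz := mem_ball_self (x := z) hρ0
  have hdiff : DifferentiableOn ℂ f (ball z ρ) := fun w hw ↦
    ((hf (mem_univ w)).meromorphicOrderAt_nonneg_iff_analyticAt.1
      (near w hw).1.ge).differentiableAt.differentiableWithinAt
  have hbound := norm_sub_sub_mul_deriv_le (φ := fun w ↦ f w / f z) (z := z) (η := η) (ρ := ρ)
    (M := Real.exp 26) (hdiff.div_const _) (fun w hw ↦ by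
      have h0 : 0 < ‖f z‖ := norm_pos_iff.2 (hne z hzz)
      have h1 : 0 < ‖f w‖ := norm_pos_iff.2 (hne w hw)
      rw [norm_div, div_le_iff₀ h0, ← Real.log_le_log_iff h1 (by positivity),
        Real.log_mul (Real.exp_pos _).ne' h0.ne', Real.log_exp]
      linarith [(near w hw).2]) (by rw [hρ]; linarith)
  rw [deriv_div_const, ← sub_div] at hbound
  rw [fwdDiff]
  refine hbound.trans ?_
  calc 32 * Real.exp 26 * ‖η‖ ^ 2 / ρ ^ 2
      = 128 * Real.exp 26 * ‖η‖ ^ 2 * r ^ (2 * β - 2) := by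
        have : r ^ (2 * β - 2) = ((r ^ (1 - β)) ^ 2)⁻¹ := by
          rw [← Real.rpow_natCast, ← Real.rpow_mul hr0.le, ← Real.rpow_neg hr0.le]
          congr 1
          push_cast
          ring
        rw [this, hρ]
        field_simp
        ring
    _ ≤ (128 * Real.exp 26 * ‖η‖ ^ 2 + 1) * r ^ (2 * σ - 2 + ε) := by
        have := Real.rpow_le_rpow_of_exponent_le hr1.le (by linarith : 2 * β - 2 ≤ 2 * σ - 2 + ε)
        gcongr
        linarith

/-- By the identity principle one infinite order would make all orders infinite, so `f` would vanish
on a codiscrete set. -/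
theorem meromorphicOrderAt_ne_top_of_not_eventuallyEq_zero {f : ℂ → ℂ} (hf : Meromorphic f)
    (hf0 : ¬ f =ᶠ[codiscrete ℂ] 0) (u : ℂ) : meromorphicOrderAt f u ≠ ⊤ := by
  have key := hf.exists_meromorphicOrderAt_ne_top_iff_forall
  refine key.1 ?_ u
  by_contra! h
  refine hf0 ?_
  filter_upwards [hf.meromorphicOn.meromorphicNFAt_mem_codiscreteWithin] with z hz
  by_contra h1
  have := hz.meromorphicOrderAt_eq_zero_iff.2 h1
  simp [h z] at this

theorem theorem4p1 (f : ℂ → ℂ) (hf : Meromorphic f)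
    (hf0 : ¬ f =ᶠ[Filter.codiscrete ℂ] 0)
    (σ : ℝ) (hσ : nevanlinnaOrder f = (σ : EReal)) (hσ1 : σ < 1)
    (η : ℂ) (hη : η ≠ 0) (ε : ℝ) (hε : 0 < ε) :
    ∃ E : Set ℝ, E ⊆ Set.Ioi 1 ∧ MeasurableSet E ∧ logarithmicMeasure E < ⊤ ∧
      (∀ z : ℂ, ‖z‖ ∉ E ∪ Set.Icc 0 1 →
        AnalyticAt ℂ f z ∧ AnalyticAt ℂ f (z + η) ∧ f z ≠ 0) ∧
      ∃ K > (0 : ℝ), ∃ r₀ > (0 : ℝ), ∀ z : ℂ, ‖z‖ ∉ E ∪ Set.Icc 0 1 → r₀ < ‖z‖ →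
        ‖fwdDiff η f z / f z - η * (deriv f z / f z)‖ ≤ K * ‖z‖ ^ (2 * σ - 2 + ε) := by
  have htop := meromorphicOrderAt_ne_top_of_not_eventuallyEq_zero hf hf0
  have hfU : MeromorphicOn f univ := hf.meromorphicOn
  -- Normalising changes `f` only off a codiscrete set, so orders and the characteristic (at `r ≠
  -- 0`) survive. Where `f` is analytic the two agree in a neighbourhood.
  set g := toMeromorphicNFOn f univ with hg
  have hgNF : MeromorphicNFOn g univ := meromorphicNFOn_toMeromorphicNFOn f univ
  have hgtop (u : ℂ) : meromorphicOrderAt g u ≠ ⊤ := by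
    rw [hg, meromorphicOrderAt_toMeromorphicNFOn hfU (mem_univ u)]
    exact htop u
  have hfg : f =ᶠ[codiscrete ℂ] g := toMeromorphicNFOn_eqOn_codiscrete hfU
  have hgσ : nevanlinnaOrder g = (σ : EReal) := by
    rw [← hσ]
    refine limsup_congr ?_
    filter_upwards [eventually_ne_atTop 0] with r hr
    rw [ValueDistribution.characteristic_congr_codiscrete hfg hr]
  have hloc (z : ℂ) (hz : AnalyticAt ℂ f z) : f =ᶠ[𝓝 z] g :=
    (hz.meromorphicNFAt.eventuallyEq_nhdsNE_iff_eventuallyEq_nhds (hgNF (mem_univ z))).1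
      (hfU.toMeromorphicNFOn_eq_self_on_nhdsNE (mem_univ z)).symm
  obtain ⟨E, hE1, hEm, hEfin, K, hK, r₀, hr₀, hE⟩ :=
    hgNF.exists_norm_fwdDiff_div_sub_le hgtop hgσ hσ1 η hε
  set P : Set ℂ := {z | AnalyticAt ℂ f z}ᶜ with hP
  set Z : Set ℂ := (MeromorphicOn.divisor f univ).support with hZ
  have hPc : P.Countable := hf.countable_compl_analyticAt
  have hZc : Z.Countable := Function.locallyFinsuppWithin.countable_support _
  -- The radii of points where `f` or its translate by `η` is not analytic, and of zeros and poles: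
  -- again countable.
  set B : Set ℝ := (norm '' P ∪ (fun z ↦ ‖z - η‖) '' P ∪ norm '' Z) ∩ Ioi 1 with hB
  have hBc : B.Countable :=
    (((hPc.image _).union (hPc.image _)).union (hZc.image _)).mono inter_subset_left
  have hgood (z : ℂ) (hz : ‖z‖ ∉ E ∪ B ∪ Icc 0 1) :
      AnalyticAt ℂ f z ∧ AnalyticAt ℂ f (z + η) ∧ f z ≠ 0 := by
    simp only [mem_union, not_or] at hz
    obtain ⟨⟨-, hzB⟩, hz1⟩ := hz
    have hz1 : ‖z‖ ∈ Ioi (1 : ℝ) := by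
      by_contra h
      exact hz1 ⟨norm_nonneg z, not_lt.1 h⟩
    have h1 : AnalyticAt ℂ f z := by
      by_contra h
      exact hzB ⟨Or.inl (Or.inl ⟨z, h, rfl⟩), hz1⟩
    refine ⟨h1, ?_, ?_⟩
    · by_contra h
      exact hzB ⟨Or.inl (Or.inr ⟨z + η, h, by simp⟩), hz1⟩
    · refine h1.meromorphicNFAt.meromorphicOrderAt_eq_zero_iff.1 ?_
      by_contra h
      refine hzB ⟨Or.inr ⟨z, ?_, rfl⟩, hz1⟩
      rw [hZ, Function.mem_support, MeromorphicOn.divisor_apply hfU (mem_univ z), Ne,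
        WithTop.untop₀_eq_zero]
      simp [htop z, h]
  refine ⟨E ∪ B, union_subset hE1 inter_subset_right, hEm.union hBc.measurableSet, ?_, hgood,
    K, hK, r₀, hr₀, fun z hz hzr ↦ ?_⟩
  · refine (logarithmicMeasure_union_le E B).trans_lt ?_
    rwa [logarithmicMeasure_of_countable hBc, add_zero]
  · obtain ⟨h1, h2, -⟩ := hgood z hz
    have e1 := hloc z h1
    have := hE z (fun h ↦ hz (h.elim (fun h ↦ Or.inl (Or.inl h)) Or.inr)) hzr
    rwa [fwdDiff, ← e1.eq_of_nhds, ← (hloc (z + η) h2).eq_of_nhds, ← e1.deriv_eq] at this
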